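/- For an integer $N\ge 1$ and real numbers $R,L>0$, $\gamma\ge 0$, put $\sigma=\gamma/L$ and suppose $\sigma\in[0,\sqrt N]$. Define the following quantities. * $u(\sigma)\ge 1$ is the unique solution $u\ge 1$ of $\sigma^2=u^2-1-2\log u$. * $\ell_N(\sigma)=\sqrt{1+N\nu}$, where $\nu\in[0,1]$ is the unique solution in $[0,1]$ of $\sum_{k=0}^{N-1}\frac{(N-k)\nu^2}{1+(N-(k+1))\nu}=\sigma^2$. * For $a\in\mathbb R^N$, $\tau,\nu_\star\in\mathbb R$ and $\nu_0,\dots,\nu_N\in\mathbb R$, let $\Lambda(\nu,\tau,a)$ be the symmetric $(2N+2)\times(2N+2)$ matrix, with rows and columns indexed by symbols $x,g_0,\dots,g_N,e_0,\dots,e_{N-1}$, whose entries are $\Lambda_{x,x}=\nu_\star$, $\Lambda_{x,g_i}=-\frac1{2(N+1)}$, $\Lambda_{g_i,g_i}=\nu_i$, $\Lambda_{g_i,g_j}=\frac{a_j}{2(N-j)}$ for $j<i$, $\Lambda_{g_i,e_j}=\frac{a_j}{2(N-j)}$ for $j<i$, $\Lambda_{e_j,e_j}=\tau$, and all other entries (up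 to symmetry) are zero. Then $$u_N^{\mathbb S}(\sigma)=\sqrt{N+1}\cdot\inf\Big\{\tau\sigma^2+\nu_\star+\sum_{k=0}^N\nu_k \;:\; \alpha\in\mathbb R_{\ge0}^N,\ \tau\ge0,\ \nu_\star,\nu_0,\dots,\nu_N\ge0,\ \Lambda(\nu,\tau,\alpha L/R)\succeq0\Big\}$$ (by rescaling $\alpha$, this value does not depend on $R,L$ for given $\sigma$). * $u_N^{\mathbb L}(\sigma)\ge 0$ is given by $$\big(u_N^{\mathbb L}(\sigma)\big)^2=\inf\Big\{\frac{\sigma^2+\sum_{k=0}^N y_k}{(N+1)y_0}\;:\; y_0>0,\ y_{k+1}\ge y_k+y_k^2\ \text{ for } k=0,\dots,N-1\Big\}.$$ Then, for every $N\ge1$ and $\sigma=\gamma/L\in[0,\sqrt N]$, $$\Big(1-\frac52\,\frac{\log(N+1)}{N}\Big)u(\sigma)\le \ell_N(\sigma)\le u_N^{\mathbb S}(\sigma)\le u_N^{\mathbb L}(\sigma)\le u(\sigma).$$ Consequently the relative gaps to the lower bound $\ell_N$ are $O(\log N/N)$, uniformly in $\sigma$: there is an absolute constant $C>0$ such that for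 all $N\ge2$, all $\sigma\in[0,\sqrt N]$ and each $v\in\{u_N^{\mathbb S}(\sigma),\,u_N^{\mathbb L}(\sigma),\,u(\sigma)\}$, $$\frac{v-\ell_N(\sigma)}{\ell_N(\sigma)}\le C\,\frac{\log N}{N}.$$ -/

import Mathlib

namespace SubgradSqueeze

noncomputable section

/-! ### The function `u` -/

/-- The set of solutions `u ≥ 1` of `σ² = u² - 1 - 2 log u`; it has exactly one element,
see `existsUnique_uSol`. -/
def uSol (σ : ℝ) : Set ℝ := {u | 1 ≤ u ∧ σ ^ 2 = u ^ 2 - 1 - 2 * Real.log u}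

/-- `u(σ)`: the unique `u ≥ 1` with `σ² = u² - 1 - 2 log u`. -/
def u (σ : ℝ) : ℝ := sInf (uSol σ)

theorem existsUnique_uSol (σ : ℝ) : ∃! x : ℝ, x ∈ uSol σ := by
  have hmono : StrictMonoOn (fun x : ℝ => x ^ 2 - 1 - 2 * Real.log x) (Set.Ici 1) := by
    intro x hx y hy hxy
    have hx1 : (1 : ℝ) ≤ x := hx
    have hx0 : 0 < x := by linarith
    have hy0 : 0 < y := by linarith
    have h1 : Real.log (y / x) ≤ y / x - 1 := Real.log_le_sub_one_of_pos (by positivity)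
    rw [Real.log_div hy0.ne' hx0.ne'] at h1
    have h2 : y / x - 1 ≤ y - x := by
      rw [div_sub_one hx0.ne']
      exact div_le_self (by linarith) hx1
    show x ^ 2 - 1 - 2 * Real.log x < y ^ 2 - 1 - 2 * Real.log y
    nlinarith
  have hcont : ContinuousOn (fun x : ℝ => x ^ 2 - 1 - 2 * Real.log x) (Set.Icc 1 (1 + |σ|)) := by
    refine ContinuousOn.sub (by fun_prop) (ContinuousOn.mul (by fun_prop) ?_)
    exact Real.continuousOn_log.mono fun x hx => by
      have := hx.1
      simp only [Set.mem_compl_iff, Set.mem_singleton_iff]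
      linarith
  have hs := abs_nonneg σ
  have hmem : σ ^ 2 ∈ Set.Icc ((1 : ℝ) ^ 2 - 1 - 2 * Real.log 1)
      ((1 + |σ|) ^ 2 - 1 - 2 * Real.log (1 + |σ|)) := by
    have h1 : Real.log (1 + |σ|) ≤ (1 + |σ|) - 1 := Real.log_le_sub_one_of_pos (by positivity)
    have h2 := sq_abs σ
    constructor
    · simp only [Real.log_one]
      nlinarith
    · nlinarith
  obtain ⟨x, hx, hxe⟩ := intermediate_value_Icc (by linarith) hcont hmem
  refine ⟨x, ⟨hx.1, hxe.symm⟩, ?_⟩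
  rintro y ⟨hy1, hye⟩
  exact hmono.injOn hy1 hx.1 (hye.symm.trans hxe.symm)

theorem u_mem (σ : ℝ) : u σ ∈ uSol σ := by
  obtain ⟨x, hx, hxu⟩ := existsUnique_uSol σ
  have hset : uSol σ = {x} := Set.eq_singleton_iff_unique_mem.2 ⟨hx, hxu⟩
  have : u σ = x := by rw [u, hset, csInf_singleton]
  rwa [this]

/-! ### The lower bound `ℓ_N` -/

/-- The set of solutions `ν ∈ [0, 1]` of
`∑_{k=0}^{N-1} (N - k) ν² / (1 + (N - (k + 1)) ν) = σ²`; for `1 ≤ N` and `0 ≤ σ ≤ √N` it has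
exactly one element, see `existsUnique_nuSol`. -/
def nuSol (N : ℕ) (σ : ℝ) : Set ℝ :=
  {ν | ν ∈ Set.Icc (0 : ℝ) 1 ∧
    ∑ k ∈ Finset.range N,
      (((N : ℝ) - k) * ν ^ 2) / (1 + ((N : ℝ) - (k + 1)) * ν) = σ ^ 2}

/-- The unique solution `ν ∈ [0, 1]`. -/
def nu (N : ℕ) (σ : ℝ) : ℝ := sInf (nuSol N σ)

/-- `ℓ_N(σ) = √(1 + N ν)`. -/
def ell (N : ℕ) (σ : ℝ) : ℝ := √(1 + N * nu N σ)

theorem existsUnique_nuSol (N : ℕ) (hN : 1 ≤ N) (σ : ℝ) (hσ : σ ∈ Set.Icc 0 √(N : ℝ)) :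
    ∃! ν : ℝ, ν ∈ nuSol N σ := by
  have hk : ∀ k ∈ Finset.range N, (0 : ℝ) ≤ (N : ℝ) - (k + 1) := by
    intro k hk
    have h : k + 1 ≤ N := Finset.mem_range.1 hk
    have h' : ((k + 1 : ℕ) : ℝ) ≤ N := by exact_mod_cast h
    push_cast at h'
    linarith
  have hmono : StrictMonoOn (fun ν : ℝ => ∑ k ∈ Finset.range N,
      (((N : ℝ) - k) * ν ^ 2) / (1 + ((N : ℝ) - (k + 1)) * ν)) (Set.Icc 0 1) := by
    intro x hx y hy hxy
    refine Finset.sum_lt_sum_of_nonempty ⟨0, Finset.mem_range.2 hN⟩ fun k hkm => ?_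
    have hm := hk k hkm
    have hx0 := hx.1
    have hy0 := hy.1
    rw [div_lt_div_iff₀ (by positivity) (by positivity)]
    have h1 : x ^ 2 * (1 + ((N : ℝ) - (k + 1)) * y) < y ^ 2 * (1 + ((N : ℝ) - (k + 1)) * x) := by
      have h2 : x ^ 2 < y ^ 2 := by nlinarith
      have h3 : 0 ≤ ((N : ℝ) - (k + 1)) * (x * y * (y - x)) :=
        mul_nonneg hm (mul_nonneg (mul_nonneg hx0 hy0) (by linarith))
      nlinarith
    have h4 : (0 : ℝ) < (N : ℝ) - k := by linarith
    have h5 := mul_lt_mul_of_pos_left h1 h4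
    linarith
  have hcont : ContinuousOn (fun ν : ℝ => ∑ k ∈ Finset.range N,
      (((N : ℝ) - k) * ν ^ 2) / (1 + ((N : ℝ) - (k + 1)) * ν)) (Set.Icc 0 1) := by
    refine continuousOn_finsetSum _ fun k hkm => ?_
    refine ContinuousOn.div (by fun_prop) (by fun_prop) fun x hx => ?_
    have := mul_nonneg (hk k hkm) hx.1
    linarith
  have hmem : σ ^ 2 ∈ Set.Icc
      (∑ k ∈ Finset.range N, (((N : ℝ) - k) * (0 : ℝ) ^ 2) / (1 + ((N : ℝ) - (k + 1)) * 0))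
      (∑ k ∈ Finset.range N, (((N : ℝ) - k) * (1 : ℝ) ^ 2) / (1 + ((N : ℝ) - (k + 1)) * 1)) := by
    have h1 : ∑ k ∈ Finset.range N,
        (((N : ℝ) - k) * (1 : ℝ) ^ 2) / (1 + ((N : ℝ) - (k + 1)) * 1) = (N : ℝ) := by
      rw [Finset.sum_congr rfl (g := fun _ => (1 : ℝ))]
      · simp
      · intro k hkm
        have := hk k hkm
        rw [div_eq_one_iff_eq (by linarith)]
        ring
    rw [h1]
    refine ⟨by simpa using sq_nonneg σ, ?_⟩
    have h2 := Real.sq_sqrt (Nat.cast_nonneg (α := ℝ) N)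
    have h3 := hσ.1
    have h4 := hσ.2
    nlinarith
  obtain ⟨x, hx, hxe⟩ := intermediate_value_Icc zero_le_one hcont hmem
  refine ⟨x, ⟨hx, hxe⟩, ?_⟩
  rintro y ⟨hy1, hye⟩
  exact hmono.injOn hy1 hx (hye.trans hxe.symm)

theorem nu_mem (N : ℕ) (hN : 1 ≤ N) (σ : ℝ) (hσ : σ ∈ Set.Icc 0 √(N : ℝ)) :
    nu N σ ∈ nuSol N σ := by
  obtain ⟨x, hx, hxu⟩ := existsUnique_nuSol N hN σ hσ
  have hset : nuSol N σ = {x} := Set.eq_singleton_iff_unique_mem.2 ⟨hx, hxu⟩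
  have : nu N σ = x := by rw [nu, hset, csInf_singleton]
  rwa [this]

/-! ### The semidefinite performance bound `u_N^𝕊` -/

/-- The coefficient `a_j / (2 (N - j))`. -/
def coef {N : ℕ} (a : Fin N → ℝ) (j : Fin N) : ℝ := a j / (2 * ((N : ℝ) - (j : ℕ)))

/-- The block of `Λ` indexed by the subgradients `g_0, …, g_N`: diagonal entries `ν_i`, and
entries `a_j / (2 (N - j))` with `j = min i k` at the off-diagonal positions `(i, k)`. -/
def gradBlock {N : ℕ} (ν : Fin (N + 1) → ℝ) (a : Fin N → ℝ) :
    Matrix (Fin (N + 1)) (Fin (N + 1)) ℝ :=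
  Matrix.of fun i k =>
    if h : i < k then coef a ⟨i, by omega⟩
    else if h : k < i then coef a ⟨k, by omega⟩
    else ν i

/-- The upper left block of `Λ`, indexed by `x_0 - x_⋆` and `g_0, …, g_N`. -/
def upperBlock {N : ℕ} (νstar : ℝ) (ν : Fin (N + 1) → ℝ) (a : Fin N → ℝ) :
    Matrix (Unit ⊕ Fin (N + 1)) (Unit ⊕ Fin (N + 1)) ℝ :=
  Matrix.fromBlocks
    (Matrix.of fun _ _ => νstar)
    (Matrix.of fun _ _ => -1 / (2 * ((N : ℝ) + 1)))
    (Matrix.of fun _ _ => -1 / (2 * ((N : ℝ) + 1)))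
    (gradBlock ν a)

/-- The upper right block of `Λ`, with columns indexed by the errors `e_0, …, e_{N-1}`: the entry
at `(g_i, e_j)` is `a_j / (2 (N - j))` if `j < i`, all other entries are zero. -/
def errBlock {N : ℕ} (a : Fin N → ℝ) : Matrix (Unit ⊕ Fin (N + 1)) (Fin N) ℝ :=
  Matrix.fromRows 0 (Matrix.of fun i j => if (j : ℕ) < (i : ℕ) then coef a j else 0)

/-- The matrix `Λ(ν, τ, a)` of size `2 N + 2`. -/
def Lam {N : ℕ} (νstar : ℝ) (ν : Fin (N + 1) → ℝ) (τ : ℝ) (a : Fin N → ℝ) :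
    Matrix ((Unit ⊕ Fin (N + 1)) ⊕ Fin N) ((Unit ⊕ Fin (N + 1)) ⊕ Fin N) ℝ :=
  Matrix.fromBlocks (upperBlock νstar ν a) (errBlock a) (errBlock a).transpose
    (τ • (1 : Matrix (Fin N) (Fin N) ℝ))

/-- The objective values attained on the feasible set of the semidefinite program. -/
def valuesS (N : ℕ) (R L σ : ℝ) : Set ℝ :=
  {v | ∃ (α : Fin N → ℝ) (τ νstar : ℝ) (ν : Fin (N + 1) → ℝ),
    (∀ k, 0 ≤ α k) ∧ 0 ≤ τ ∧ 0 ≤ νstar ∧ (∀ k, 0 ≤ ν k) ∧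
    (Lam νstar ν τ (fun k => α k * L / R)).PosSemidef ∧
    v = τ * σ ^ 2 + νstar + ∑ k, ν k}

/-- `u_N^𝕊(σ)`. -/
def uS (N : ℕ) (R L σ : ℝ) : ℝ := √((N : ℝ) + 1) * sInf (valuesS N R L σ)

/-! ### The second-order cone performance bound `u_N^𝕃` -/

/-- The objective values attained on the feasible set of the second-order cone program. The
objective is a quotient by `(N + 1) y_0`, so `y_0` has to be positive. -/
def valuesL (N : ℕ) (σ : ℝ) : Set ℝ :=
  {v | ∃ y : ℕ → ℝ, 0 < y 0 ∧ (∀ k < N, y k + y k ^ 2 ≤ y (k + 1)) ∧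
    v = (σ ^ 2 + ∑ k ∈ Finset.range (N + 1), y k) / (((N : ℝ) + 1) * y 0)}

/-- `u_N^𝕃(σ)`, the nonnegative number whose square is the value of the program. -/
def uL (N : ℕ) (σ : ℝ) : ℝ := √(sInf (valuesL N σ))

end

end SubgradSqueeze

/-!
The gap between `ℓ_N` and `u` is governed by `φ(w) = w - 1 - log w`, which increases on `[1, ∞)` and
satisfies `φ(u²) = σ²`. Reversing the sum that defines `ν` turns it into
`N ν - (1 - ν) ∑ ν / (1 + m ν)`, which a sum-versus-logarithm comparison bounds by
`φ(ℓ_N²) + ν log (N + 1)`; this is at most `φ(ℓ_N² (1 + log (N + 1) / N))`.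

For `u_N^𝕃 ≤ u`, the recursion is satisfied by `y_k = 1 / (c - k)`, the discrete analogue of the
solution of `y' = y²`, and `c` is chosen so that the harmonic sum `∑ y_k` is at most `log w`, with
`w` slightly above `u²`.

For `u_N^𝕊 ≤ u_N^𝕃`, a sequence `y` gives the multipliers `ν_k = τ y_k` and
`a_j / (2 (N - j)) = τ y_j`. In terms of the tail sums of the `g_i` the quadratic form of `Λ` then
telescopes, up to squares, to a form in the two vectors `x` and `∑ g_i`.

For `ℓ_N ≤ u_N^𝕊`, pair `Λ` with the Gram matrix of a worst-case instance: unit vectors `g_i` with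
pairwise inner products `ν`, the direction `x` of `∑ g_i`, and errors `e_j` proportional to
`∑_{i > j} g_i` such that `g_j + e_j` is orthogonal to `∑_{i > j} g_i`. All terms with an unknown
multiplier `a_j` vanish, and the errors have total square `σ²`.
-/

namespace SubgradSqueeze

open Finset Matrix
open Real (log)
open scoped RealInnerProductSpace

/-! ### The gap between `ℓ_N` and `u` -/

theorem log_sub_log_le_sum {x : ℕ → ℝ} {n : ℕ} (hx : ∀ k ≤ n, 0 < x k) :
    log (x n) - log (x 0) ≤ ∑ k ∈ range n, (x (k + 1) - x k) / x k := by
  rw [← sum_range_sub fun k => log (x k)]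
  refine sum_le_sum fun k hk => ?_
  have hk' := mem_range.1 hk
  have hk0 := hx k hk'.le
  have hk1 := hx (k + 1) hk'
  rw [← Real.log_div hk1.ne' hk0.ne', sub_div, div_self hk0.ne']
  exact Real.log_le_sub_one_of_pos (by positivity)

theorem log_one_add_mul_le_sum {ν : ℝ} (hν : 0 ≤ ν) (n : ℕ) :
    log (1 + n * ν) ≤ ∑ m ∈ range n, ν / (1 + m * ν) := by
  have h := log_sub_log_le_sum (x := fun m => 1 + m * ν) (n := n) fun m _ => by positivity
  simpa [add_mul] using h

theorem strictMonoOn_sub_one_sub_log : StrictMonoOn (fun w : ℝ => w - 1 - log w) (Set.Ici 1) := by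
  intro x (hx : 1 ≤ x) y _ hxy
  have hx0 : 0 < x := by linarith
  have hy0 : 0 < y := hx0.trans hxy
  have hlog : log y - log x < y / x - 1 := by
    rw [← Real.log_div hy0.ne' hx0.ne']
    exact Real.log_lt_sub_one_of_pos (div_pos hy0 hx0) ((one_lt_div hx0).2 hxy).ne'
  have hdiv : y / x - 1 ≤ y - x := by
    rw [div_sub_one hx0.ne']
    exact div_le_self (by linarith) hx
  change x - 1 - log x < y - 1 - log y
  linarith

theorem one_le_u (σ : ℝ) : 1 ≤ u σ := (u_mem σ).1

theorem u_sq_le_iff {σ w : ℝ} (hw : 1 ≤ w) : u σ ^ 2 ≤ w ↔ σ ^ 2 ≤ w - 1 - log w := by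
  have hφ : u σ ^ 2 - 1 - log (u σ ^ 2) = σ ^ 2 := by
    rw [(u_mem σ).2, Real.log_pow, Nat.cast_ofNat]
  rw [← hφ]
  exact (strictMonoOn_sub_one_sub_log.le_iff_le (one_le_pow₀ (one_le_u σ)) hw).symm

theorem sum_nuSol_eq {ν : ℝ} (hν : 0 ≤ ν) (N : ℕ) :
    ∑ k ∈ range N, (((N : ℝ) - k) * ν ^ 2) / (1 + ((N : ℝ) - (k + 1)) * ν)
      = N * ν - (1 - ν) * ∑ m ∈ range N, ν / (1 + m * ν) := by
  have hterm : ∀ m ∈ range N,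
      (((N : ℝ) - (N - 1 - m : ℕ)) * ν ^ 2) / (1 + ((N : ℝ) - ((N - 1 - m : ℕ) + 1)) * ν)
        = ν - (1 - ν) * (ν / (1 + m * ν)) := by
    intro m hm
    have hm' : m < N := mem_range.1 hm
    have hcast : ((N - 1 - m : ℕ) : ℝ) = N - 1 - m := by
      rw [Nat.cast_sub (by omega), Nat.cast_sub (by omega), Nat.cast_one]
    have hden : 1 + ((N : ℝ) - (N - 1 - m + 1)) * ν = 1 + m * ν := by ring
    rw [hcast, hden]
    field_simp
    ring
  rw [← sum_range_reflect, sum_congr rfl hterm, sum_sub_distrib, ← mul_sum, sum_const, card_range,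
    nsmul_eq_mul]

theorem ell_sq {N : ℕ} {σ : ℝ} (hν : 0 ≤ nu N σ) : ell N σ ^ 2 = 1 + N * nu N σ :=
  Real.sq_sqrt (by positivity)

theorem one_le_ell {N : ℕ} {σ : ℝ} (hν : 0 ≤ nu N σ) : 1 ≤ ell N σ := by
  rw [ell, Real.one_le_sqrt, le_add_iff_nonneg_right]
  positivity

theorem sq_le_of_mem_nuSol {N : ℕ} {σ ν : ℝ} (hν : ν ∈ nuSol N σ) :
    σ ^ 2 ≤ N * ν - log (1 + N * ν) + ν * log (N + 1) := by
  obtain ⟨⟨hν0, hν1⟩, hsum⟩ := hν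
  have hlog : log (1 + N * ν) ≤ log (N + 1) :=
    Real.log_le_log (by positivity) (by nlinarith [Nat.cast_nonneg (α := ℝ) N])
  calc σ ^ 2 = N * ν - (1 - ν) * ∑ m ∈ range N, ν / (1 + m * ν) := by
        rw [← hsum, sum_nuSol_eq hν0]
    _ ≤ N * ν - (1 - ν) * log (1 + N * ν) := by
        have := sub_nonneg.2 hν1
        gcongr
        exact log_one_add_mul_le_sum hν0 N
    _ = N * ν - log (1 + N * ν) + ν * log (1 + N * ν) := by ring
    _ ≤ N * ν - log (1 + N * ν) + ν * log (N + 1) := by gcongr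

theorem sub_one_sub_log_add_le {w ε : ℝ} (hw : 0 < w) (hε : 0 ≤ ε) :
    w - 1 - log w + (w - 1) * ε ≤ w * (1 + ε) - 1 - log (w * (1 + ε)) := by
  have hlog : log (1 + ε) ≤ ε := by
    linarith [Real.log_le_sub_one_of_pos (show 0 < 1 + ε by linarith)]
  rw [Real.log_mul hw.ne' (by linarith)]
  linarith

section Gap

variable {N : ℕ} {σ : ℝ}

theorem log_add_one_div_nonneg (N : ℕ) : 0 ≤ log ((N : ℝ) + 1) / N :=
  div_nonneg (Real.log_nonneg (by linarith [Nat.cast_nonneg (α := ℝ) N])) (Nat.cast_nonneg N)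

theorem u_sq_le_mul_ell_sq (hN : 1 ≤ N) (hσ : σ ∈ Set.Icc 0 √(N : ℝ)) :
    u σ ^ 2 ≤ ell N σ ^ 2 * (1 + log ((N : ℝ) + 1) / N) := by
  have hν := nu_mem N hN σ hσ
  have hN0 : (N : ℝ) ≠ 0 := by positivity
  have hw : 1 ≤ ell N σ ^ 2 := one_le_pow₀ (one_le_ell hν.1.1)
  have hε := log_add_one_div_nonneg N
  rw [u_sq_le_iff (one_le_mul_of_one_le_of_one_le hw (by linarith))]
  calc σ ^ 2 ≤ N * nu N σ - log (1 + N * nu N σ) + nu N σ * log (N + 1) := sq_le_of_mem_nuSol hν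
    _ = ell N σ ^ 2 - 1 - log (ell N σ ^ 2) + (ell N σ ^ 2 - 1) * (log (N + 1) / N) := by
        rw [ell_sq hν.1.1]
        field_simp
        ring
    _ ≤ _ := sub_one_sub_log_add_le (by positivity) hε

theorem u_le_mul_ell (hN : 1 ≤ N) (hσ : σ ∈ Set.Icc 0 √(N : ℝ)) :
    u σ ≤ (1 + log ((N : ℝ) + 1) / N / 2) * ell N σ := by
  have hε := log_add_one_div_nonneg N
  have hell : 0 ≤ ell N σ := Real.sqrt_nonneg _
  calc u σ ≤ √(ell N σ ^ 2 * (1 + log ((N : ℝ) + 1) / N)) :=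
        Real.le_sqrt_of_sq_le (u_sq_le_mul_ell_sq hN hσ)
    _ = √(1 + log ((N : ℝ) + 1) / N) * ell N σ := by
        rw [Real.sqrt_mul (sq_nonneg _), Real.sqrt_sq hell, mul_comm]
    _ ≤ _ := by
        gcongr
        exact Real.sqrt_one_add_le (by linarith)

theorem one_sub_mul_u_le_ell (hN : 1 ≤ N) (hσ : σ ∈ Set.Icc 0 √(N : ℝ)) {c : ℝ} (hc : 1 / 2 ≤ c) :
    (1 - c * (log ((N : ℝ) + 1) / N)) * u σ ≤ ell N σ := by
  have hε := log_add_one_div_nonneg N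
  have hu := one_le_u σ
  have hul := u_le_mul_ell hN hσ
  set ε := log ((N : ℝ) + 1) / N
  have hcε : ε / 2 ≤ c * ε := by nlinarith
  rcases le_total (u σ) (ell N σ) with h | h
  · nlinarith
  · calc (1 - c * ε) * u σ ≤ (1 - ε / 2) * u σ := by gcongr
      _ ≤ (1 + ε / 2) * ell N σ - ε / 2 * u σ := by linarith
      _ ≤ (1 + ε / 2) * ell N σ - ε / 2 * ell N σ := by gcongr
      _ = ell N σ := by ring

theorem log_add_one_le_two_mul_log {x : ℝ} (hx : 2 ≤ x) : log (x + 1) ≤ 2 * log x := by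
  rw [← Nat.cast_ofNat, ← Real.log_pow]
  exact Real.log_le_log (by linarith) (by nlinarith)

theorem sub_ell_div_ell_le (hN : 2 ≤ N) (hσ : σ ∈ Set.Icc 0 √(N : ℝ)) {v : ℝ} (hv : v ≤ u σ) :
    (v - ell N σ) / ell N σ ≤ log N / N := by
  have hl : 1 ≤ ell N σ := one_le_ell (nu_mem N (by omega) σ hσ).1.1
  have hlog := log_add_one_le_two_mul_log (x := N) (by exact_mod_cast hN)
  rw [div_le_iff₀ (by linarith), sub_le_iff_le_add, ← add_one_mul, add_comm]
  calc v ≤ (1 + log ((N : ℝ) + 1) / N / 2) * ell N σ := hv.trans (u_le_mul_ell (by omega) hσ)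
    _ ≤ (1 + 2 * log N / N / 2) * ell N σ := by gcongr
    _ = (1 + log N / N) * ell N σ := by ring

end Gap

/-! ### The second-order cone bound is at most `u` -/

theorem pos_of_add_sq_le {N : ℕ} {y : ℕ → ℝ} (hy0 : 0 < y 0)
    (hy : ∀ k < N, y k + y k ^ 2 ≤ y (k + 1)) : ∀ k ≤ N, 0 < y k := by
  intro k hk
  induction k with
  | zero => exact hy0
  | succ k ih => nlinarith [ih (by omega), hy k (by omega)]

theorem sum_pos_of_add_sq_le {N : ℕ} {y : ℕ → ℝ} (hy0 : 0 < y 0)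
    (hy : ∀ k < N, y k + y k ^ 2 ≤ y (k + 1)) : 0 < ∑ k ∈ range (N + 1), y k :=
  sum_pos (fun k hk => pos_of_add_sq_le hy0 hy k (Nat.lt_succ_iff.1 (mem_range.1 hk))) (by simp)

theorem valuesL_nonneg {N : ℕ} {σ v : ℝ} (hv : v ∈ valuesL N σ) : 0 ≤ v := by
  obtain ⟨y, hy0, hy, rfl⟩ := hv
  have := sum_pos_of_add_sq_le hy0 hy
  positivity

theorem valuesL_nonempty (N : ℕ) (σ : ℝ) : (valuesL N σ).Nonempty :=
  ⟨_, fun n => Nat.rec 1 (fun _ t => t + t ^ 2) n, one_pos, fun _ _ => le_rfl, rfl⟩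

theorem sum_one_div_sub_le_log {c : ℝ} {n : ℕ} (hc : (n : ℝ) < c) :
    ∑ k ∈ range n, 1 / (c - k) ≤ log (c / (c - n)) := by
  have hpos : ∀ k ≤ n, 0 < c - (k : ℝ) := fun k hk =>
    sub_pos.2 (hc.trans_le' (by exact_mod_cast hk))
  have h := log_sub_log_le_sum hpos
  have hterm : ∀ k : ℕ, (c - (k + 1 : ℕ) - (c - k)) / (c - k) = -(1 / (c - k)) := by
    intro k
    push_cast
    ring
  have hc0 : c ≠ 0 := by simpa using (hpos 0 n.zero_le).ne'
  rw [Real.log_div hc0 (hpos n le_rfl).ne']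
  simp only [hterm, sum_neg_distrib, Nat.cast_zero, sub_zero] at h
  linarith

theorem one_div_add_sq_le_one_div_sub_one {t : ℝ} (ht : 1 < t) :
    1 / t + (1 / t) ^ 2 ≤ 1 / (t - 1) := by
  have h1 : 0 < t - 1 := by linarith
  have h : 1 / (t - 1) - (1 / t + (1 / t) ^ 2) = 1 / (t ^ 2 * (t - 1)) := by
    field_simp
    ring
  have : 0 ≤ 1 / (t ^ 2 * (t - 1)) := by positivity
  linarith

theorem harmonic_mem_valuesL {N : ℕ} (σ : ℝ) {c : ℝ} (hc : N < c) :
    c / (N + 1) * (σ ^ 2 + ∑ k ∈ range (N + 1), 1 / (c - k)) ∈ valuesL N σ := by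
  have hc0 : 0 < c := hc.trans_le' (Nat.cast_nonneg N)
  refine ⟨fun k => 1 / (c - k), by simpa using hc0, fun k hk => ?_, ?_⟩
  · have hk' : (k : ℝ) + 1 ≤ N := by exact_mod_cast hk
    simpa [sub_sub] using one_div_add_sq_le_one_div_sub_one (t := c - k) (by linarith)
  · simp only [Nat.cast_zero, sub_zero]
    field_simp

theorem sInf_valuesL_le {σ w : ℝ} (N : ℕ) (hw : 1 < w) (hσ : σ ^ 2 ≤ w - 1 - log w) :
    sInf (valuesL N σ) ≤ w := by
  have hw1 : 0 < w - 1 := sub_pos.2 hw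
  -- the solution of `c / (c - (N + 1)) = w`
  set c : ℝ := (N + 1) * w / (w - 1) with hc
  have hc_sub : c - (N + 1) = (N + 1) / (w - 1) := by
    rw [hc]
    field_simp
    ring
  have hcN : (N : ℝ) + 1 < c := by
    have : 0 < ((N : ℝ) + 1) / (w - 1) := by positivity
    linarith
  have hsum : ∑ k ∈ range (N + 1), 1 / (c - k) ≤ log w := by
    have h := sum_one_div_sub_le_log (n := N + 1) (by exact_mod_cast hcN)
    rwa [Nat.cast_succ, hc_sub, hc, div_div_div_cancel_right₀ hw1.ne',
      mul_div_cancel_left₀ _ (by positivity)] at h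
  calc sInf (valuesL N σ) ≤ c / (N + 1) * (σ ^ 2 + ∑ k ∈ range (N + 1), 1 / (c - k)) :=
        csInf_le ⟨0, fun v => valuesL_nonneg⟩ (harmonic_mem_valuesL σ (by linarith))
    _ ≤ c / (N + 1) * (w - 1) := by
        gcongr
        linarith
    _ = w := by
        rw [hc]
        field_simp

theorem uL_le_u (N : ℕ) (σ : ℝ) : uL N σ ≤ u σ := by
  have hu := one_le_u σ
  rw [uL, Real.sqrt_le_left (by linarith)]
  refine le_of_forall_gt_imp_ge_of_dense fun w hw => ?_
  have hw1 : 1 < w := (one_le_pow₀ hu).trans_lt hw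
  exact sInf_valuesL_le N hw1 ((u_sq_le_iff hw1.le).1 hw.le)

/-! ### The quadratic form of `Λ` -/

theorem sum_sum_eq_sum_diag_add_two_mul_sum_Ioi {ι R : Type*} [LinearOrder ι] [Fintype ι]
    [LocallyFiniteOrderTop ι] [LocallyFiniteOrderBot ι] [NonAssocSemiring R] {f : ι → ι → R}
    (hf : ∀ i k, f i k = f k i) :
    ∑ i, ∑ k, f i k = ∑ i, f i i + 2 * ∑ i, ∑ k > i, f i k := by
  have hoff := sum_sum_Ioi_add_eq_sum_sum_off_diag f
  simp only [fun i k => hf k i, ← two_mul, ← mul_sum] at hoff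
  rw [hoff, ← sum_add_distrib]
  exact sum_congr rfl fun i _ => Fintype.sum_eq_add_sum_compl i _

section InnerProductSpace

variable {E : Type*} [NormedAddCommGroup E] [InnerProductSpace ℝ E] {N : ℕ}

theorem sum_mul_inner_nonneg {ι : Type*} [Fintype ι] {A : Matrix ι ι ℝ} (hA : A.PosSemidef)
    (v : ι → E) : 0 ≤ ∑ p, ∑ q, A p q * ⟪v p, v q⟫ := by
  simpa [dotProduct, mulVec, gram_apply] using
    (hA.hadamard (posSemidef_gram ℝ v)).dotProduct_mulVec_nonneg 1

theorem gradBlock_isSymm (ν : Fin (N + 1) → ℝ) (a : Fin N → ℝ) : (gradBlock ν a).IsSymm := by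
  ext i k
  rcases lt_trichotomy i k with h | h | h <;> simp [gradBlock, h, h.not_gt]

theorem gradBlock_self (ν : Fin (N + 1) → ℝ) (a : Fin N → ℝ) (i : Fin (N + 1)) :
    gradBlock ν a i i = ν i := by
  simp [gradBlock]

theorem gradBlock_castSucc_of_lt (ν : Fin (N + 1) → ℝ) (a : Fin N → ℝ) {j : Fin N}
    {k : Fin (N + 1)} (h : j.castSucc < k) : gradBlock ν a j.castSucc k = coef a j := by
  simp [gradBlock, h]

theorem sum_gradBlock_mul_inner (ν : Fin (N + 1) → ℝ) (a : Fin N → ℝ) (g : Fin (N + 1) → E) :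
    ∑ i, ∑ k, gradBlock ν a i k * ⟪g i, g k⟫ = ∑ i, ν i * ‖g i‖ ^ 2
      + 2 * ∑ j : Fin N, coef a j * ⟪g j.castSucc, ∑ i > j.castSucc, g i⟫ := by
  rw [sum_sum_eq_sum_diag_add_two_mul_sum_Ioi fun i k => by
    rw [(gradBlock_isSymm ν a).apply, real_inner_comm]]
  simp only [gradBlock_self, real_inner_self_eq_norm_sq]
  congr 2
  rw [Fin.sum_univ_castSucc, ← Fin.top_eq_last, Ioi_top, sum_empty, add_zero]
  refine sum_congr rfl fun j _ => ?_
  rw [inner_sum, mul_sum]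
  exact sum_congr rfl fun k hk => by rw [gradBlock_castSucc_of_lt ν a (mem_Ioi.1 hk)]

theorem sum_ite_lt_mul_inner (a : Fin N → ℝ) (g : Fin (N + 1) → E) (e : Fin N → E) :
    ∑ i : Fin (N + 1), ∑ j : Fin N, (if (j : ℕ) < i then coef a j else 0) * ⟪g i, e j⟫
      = ∑ j : Fin N, coef a j * ⟪e j, ∑ i > j.castSucc, g i⟫ := by
  rw [sum_comm]
  refine sum_congr rfl fun j _ => ?_
  simp only [ite_mul, zero_mul, inner_sum, mul_sum, real_inner_comm (e j)]
  rw [← sum_filter]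
  exact sum_congr (by ext; simp [Fin.lt_def]) fun _ _ => rfl

theorem sum_Lam_mul_inner (νstar : ℝ) (ν : Fin (N + 1) → ℝ) (τ : ℝ) (a : Fin N → ℝ) (x : E)
    (g : Fin (N + 1) → E) (e : Fin N → E) :
    let v : (Unit ⊕ Fin (N + 1)) ⊕ Fin N → E := Sum.elim (Sum.elim (fun _ => x) g) e
    ∑ p, ∑ q, Lam νstar ν τ a p q * ⟪v p, v q⟫
      = νstar * ‖x‖ ^ 2 - ⟪x, ∑ i, g i⟫ / (N + 1) + ∑ i, ν i * ‖g i‖ ^ 2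
        + 2 * ∑ j : Fin N, coef a j * ⟪g j.castSucc + e j, ∑ i > j.castSucc, g i⟫
        + τ * ∑ j, ‖e j‖ ^ 2 := by
  intro v
  have hge := sum_ite_lt_mul_inner a g e
  have heg : ∑ j : Fin N, ∑ i : Fin (N + 1), (if (j : ℕ) < i then coef a j else 0) * ⟪e j, g i⟫
      = ∑ j : Fin N, coef a j * ⟪e j, ∑ i > j.castSucc, g i⟫ := by
    rw [← hge, sum_comm]
    simp only [real_inner_comm]
  have hxg : ∑ i, -1 / (2 * ((N : ℝ) + 1)) * ⟪x, g i⟫ = -(⟪x, ∑ i, g i⟫ / (N + 1)) / 2 := by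
    rw [← mul_sum, inner_sum]
    field_simp
  have hgx : ∑ i, -1 / (2 * ((N : ℝ) + 1)) * ⟪g i, x⟫ = -(⟪x, ∑ i, g i⟫ / (N + 1)) / 2 := by
    simpa only [real_inner_comm] using hxg
  have hee : ∑ j, ∑ k, (τ • (1 : Matrix (Fin N) (Fin N) ℝ)) j k * ⟪e j, e k⟫
      = τ * ∑ j, ‖e j‖ ^ 2 := by
    simp [one_apply, mul_sum]
  simp only [v, Fintype.sum_sum_type, univ_unique, sum_singleton, Sum.elim_inl, Sum.elim_inr, Lam,
    upperBlock, errBlock, fromBlocks_apply₁₁, fromBlocks_apply₁₂, fromBlocks_apply₂₁,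
    fromBlocks_apply₂₂, fromRows_apply_inl, fromRows_apply_inr, of_apply, transpose_apply,
    Matrix.zero_apply, zero_mul, sum_const_zero, add_zero, zero_add, sum_add_distrib,
    real_inner_self_eq_norm_sq]
  rw [hxg, hgx, hge, heg, hee, sum_gradBlock_mul_inner]
  simp only [inner_add_left, mul_add, sum_add_distrib]
  ring

theorem mul_norm_add_sq_sub_le {y y' : ℝ} (hy : y + y ^ 2 ≤ y') (g e T : E) :
    y * ‖g + T‖ ^ 2 - y' * ‖T‖ ^ 2 ≤ y * ‖g‖ ^ 2 + 2 * (y * ⟪g + e, T⟫) + ‖e‖ ^ 2 := by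
  have hsq : ‖e + y • T‖ ^ 2 = ‖e‖ ^ 2 + 2 * (y * ⟪e, T⟫) + y ^ 2 * ‖T‖ ^ 2 := by
    rw [norm_add_sq_real, inner_smul_right, norm_smul, mul_pow, Real.norm_eq_abs, sq_abs]
  rw [norm_add_sq_real, inner_add_left]
  nlinarith [sq_nonneg ‖e + y • T‖, mul_le_mul_of_nonneg_right hy (sq_nonneg ‖T‖)]

theorem mul_norm_sum_sq_le {y : ℕ → ℝ} (hy : ∀ k < N, y k + y k ^ 2 ≤ y (k + 1))
    (g : Fin (N + 1) → E) (e : Fin N → E) :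
    y 0 * ‖∑ i, g i‖ ^ 2 ≤ ∑ i : Fin (N + 1), y i * ‖g i‖ ^ 2
      + 2 * ∑ j : Fin N, y j * ⟪g j.castSucc + e j, ∑ i > j.castSucc, g i⟫ + ∑ j, ‖e j‖ ^ 2 := by
  set T : Fin (N + 1) → E := fun i => ∑ k ≥ i, g k with hT
  have hT_last : T (Fin.last N) = g (Fin.last N) := by
    simp [hT, ← Fin.top_eq_last, Ici_top]
  have hT_zero : T 0 = ∑ i, g i := by
    simp [hT, ← bot_eq_zero]
  have hIoi : ∀ j : Fin N, ∑ i > j.castSucc, g i = T j.succ := fun j =>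
    sum_congr (by ext; simp [Fin.castSucc_lt_iff_succ_le]) fun _ _ => rfl
  have hT_castSucc : ∀ j : Fin N, T j.castSucc = g j.castSucc + T j.succ := fun j => by
    rw [← hIoi, add_comm, sum_Ioi_add_eq_sum_Ici]
  have hstep := sum_le_sum fun (j : Fin N) (_ : j ∈ univ) =>
    mul_norm_add_sq_sub_le (hy j j.2) (g j.castSucc) (e j) (T j.succ)
  simp only [← hT_castSucc, sum_sub_distrib, sum_add_distrib, ← mul_sum] at hstep
  have htel := (Fin.sum_univ_succ fun i : Fin (N + 1) => y i * ‖T i‖ ^ 2).symm.trans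
    (Fin.sum_univ_castSucc _)
  rw [Fin.sum_univ_castSucc fun i : Fin (N + 1) => y i * ‖g i‖ ^ 2, ← hT_zero]
  simp only [Fin.val_zero, Fin.val_succ, Fin.val_castSucc, Fin.val_last, hT_last, hIoi] at htel ⊢
  linarith

theorem mul_inner_le_of_sq_le {A B c : ℝ} (hA : 0 < A) (hc : c ^ 2 ≤ 4 * A * B) (x s : E) :
    c * ⟪x, s⟫ ≤ A * ‖x‖ ^ 2 + B * ‖s‖ ^ 2 := by
  have hsq : ‖(2 * A) • x - c • s‖ ^ 2
      = 4 * A * (A * ‖x‖ ^ 2 - c * ⟪x, s⟫) + c ^ 2 * ‖s‖ ^ 2 := by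
    rw [norm_sub_sq_real, inner_smul_left, inner_smul_right, norm_smul, norm_smul, mul_pow, mul_pow,
      Real.norm_eq_abs, Real.norm_eq_abs, sq_abs, sq_abs, conj_trivial]
    ring
  have h : 0 ≤ 4 * A * (A * ‖x‖ ^ 2 + B * ‖s‖ ^ 2 - c * ⟪x, s⟫) := by
    nlinarith [sq_nonneg ‖(2 * A) • x - c • s‖, mul_le_mul_of_nonneg_right hc (sq_nonneg ‖s‖)]
  linarith [nonneg_of_mul_nonneg_right h (by positivity)]

end InnerProductSpace

/-! ### The semidefinite bound is at most the second-order cone bound -/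

theorem star_dotProduct_mulVec_eq_sum {ι : Type*} [Fintype ι] (A : Matrix ι ι ℝ) (v : ι → ℝ) :
    star v ⬝ᵥ A *ᵥ v = ∑ p, ∑ q, A p q * ⟪v p, v q⟫ := by
  simp only [dotProduct, mulVec, star_trivial, mul_sum, RCLike.inner_apply, conj_trivial]
  exact sum_congr rfl fun p _ => sum_congr rfl fun q _ => by ring

theorem Lam_isHermitian {N : ℕ} (νstar : ℝ) (ν : Fin (N + 1) → ℝ) (τ : ℝ) (a : Fin N → ℝ) :
    (Lam νstar ν τ a).IsHermitian :=
  .fromBlocks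
    (.fromBlocks (by ext; simp) (by ext; simp) (by simpa using gradBlock_isSymm ν a))
    (conjTranspose_eq_transpose_of_trivial _)
    (by simp [IsHermitian])

theorem posSemidef_Lam {N : ℕ} {y : ℕ → ℝ} (hy : ∀ k < N, y k + y k ^ 2 ≤ y (k + 1))
    {τ νstar : ℝ} (hτ : 0 ≤ τ) (hνstar : 0 < νstar)
    (hmul : 1 ≤ 4 * ((N : ℝ) + 1) ^ 2 * (τ * y 0) * νstar) {a : Fin N → ℝ}
    (ha : ∀ j, coef a j = τ * y j) : (Lam νstar (fun k => τ * y k) τ a).PosSemidef := by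
  refine PosSemidef.of_dotProduct_mulVec_nonneg (Lam_isHermitian _ _ _ _) fun v => ?_
  obtain ⟨x, g, e, rfl⟩ : ∃ x g e, v = Sum.elim (Sum.elim (fun _ : Unit => x) g) e :=
    ⟨v (.inl (.inl ())), fun i => v (.inl (.inr i)), fun j => v (.inr j), by
      ext ((_ | _) | _) <;> rfl⟩
  have htail := mul_le_mul_of_nonneg_left (mul_norm_sum_sq_le hy g e) hτ
  have hcross := mul_inner_le_of_sq_le (B := τ * y 0) (c := 1 / ((N : ℝ) + 1)) hνstar
    (by rw [div_pow, one_pow, div_le_iff₀ (by positivity)]; linarith) x (∑ i, g i)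
  have hform := sum_Lam_mul_inner νstar (fun k => τ * y k) τ a x g e
  simp only [ha, mul_assoc, ← mul_sum] at hform
  rw [one_div_mul_eq_div] at hcross
  rw [star_dotProduct_mulVec_eq_sum, hform]
  linarith

theorem mul_add_mem_valuesS {N : ℕ} {R L : ℝ} (hR : 0 < R) (hL : 0 < L) (σ : ℝ) {y : ℕ → ℝ}
    (hy0 : 0 < y 0) (hy : ∀ k < N, y k + y k ^ 2 ≤ y (k + 1)) {τ νstar : ℝ} (hτ : 0 ≤ τ)
    (hνstar : 0 < νstar) (hmul : 1 ≤ 4 * ((N : ℝ) + 1) ^ 2 * (τ * y 0) * νstar) :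
    τ * (σ ^ 2 + ∑ k ∈ range (N + 1), y k) + νstar ∈ valuesS N R L σ := by
  have hypos : ∀ k ≤ N, 0 ≤ τ * y k := fun k hk =>
    mul_nonneg hτ (pos_of_add_sq_le hy0 hy k hk).le
  have hsub : ∀ j : Fin N, 0 < (N : ℝ) - j := fun j => sub_pos.2 (by exact_mod_cast j.2)
  refine ⟨fun j => 2 * ((N : ℝ) - j) * (τ * y j) * R / L, τ, νstar, fun k => τ * y k,
    fun j => ?_, hτ, hνstar.le, fun k => hypos k (by omega),
    posSemidef_Lam hy hτ hνstar hmul fun j => ?_, ?_⟩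
  · have := hsub j
    have := hypos j j.2.le
    positivity
  · have := hsub j
    rw [coef]
    field_simp
  · rw [Fin.sum_univ_eq_sum_range fun k => τ * y k, ← mul_sum]
    ring

theorem sqrt_div_mem_valuesS {N : ℕ} {R L σ v : ℝ} (hR : 0 < R) (hL : 0 < L)
    (hv : v ∈ valuesL N σ) : √(v / (N + 1)) ∈ valuesS N R L σ := by
  obtain ⟨y, hy0, hy, rfl⟩ := hv
  have hpos := sum_pos_of_add_sq_le hy0 hy
  have hA : 0 < σ ^ 2 + ∑ k ∈ range (N + 1), y k := by positivity
  generalize hA_def : σ ^ 2 + ∑ k ∈ range (N + 1), y k = A at hA ⊢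
  set w := √(A / ((N + 1) * y 0) / (N + 1))
  have hw : 0 < w := by positivity
  have hw_sq : w ^ 2 = A / ((N + 1) * y 0) / (N + 1) := Real.sq_sqrt (by positivity)
  clear_value w
  -- `τ = w / (2 * A)` and `νstar = w / 2` minimise `τ * A + νstar` under this constraint
  have hmul : 4 * ((N : ℝ) + 1) ^ 2 * (w / (2 * A) * y 0) * (w / 2) = 1 :=
    calc _ = ((N : ℝ) + 1) ^ 2 * y 0 / A * w ^ 2 := by ring
      _ = 1 := by
        rw [hw_sq]
        field_simp
  have hval : w / (2 * A) * A + w / 2 = w := by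
    field_simp
    norm_num
  subst hA_def
  rw [← hval]
  exact mul_add_mem_valuesS hR hL σ hy0 hy (by positivity) (by positivity) hmul.ge

theorem valuesS_nonneg {N : ℕ} {R L σ v : ℝ} (hv : v ∈ valuesS N R L σ) : 0 ≤ v := by
  obtain ⟨α, τ, νstar, ν, -, hτ, hνstar, hν, -, rfl⟩ := hv
  have := sum_nonneg fun k (_ : k ∈ univ) => hν k
  positivity

theorem valuesS_nonempty (N : ℕ) {R L : ℝ} (σ : ℝ) (hR : 0 < R) (hL : 0 < L) :
    (valuesS N R L σ).Nonempty :=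
  let ⟨_, hv⟩ := valuesL_nonempty N σ
  ⟨_, sqrt_div_mem_valuesS hR hL hv⟩

theorem uS_le_uL (N : ℕ) {R L : ℝ} (σ : ℝ) (hR : 0 < R) (hL : 0 < L) : uS N R L σ ≤ uL N σ := by
  have hbdd : BddBelow (valuesS N R L σ) := ⟨0, fun _ => valuesS_nonneg⟩
  have huS : 0 ≤ uS N R L σ := mul_nonneg (by positivity) (Real.sInf_nonneg fun _ => valuesS_nonneg)
  refine Real.le_sqrt_of_sq_le (le_csInf (valuesL_nonempty N σ) fun v hv => ?_)
  have hv0 := valuesL_nonneg hv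
  rw [← Real.le_sqrt huS hv0]
  calc uS N R L σ ≤ √((N : ℝ) + 1) * √(v / (N + 1)) := by
        rw [uS]
        gcongr
        exact csInf_le hbdd (sqrt_div_mem_valuesS hR hL hv)
    _ = √v := by
        rw [← Real.sqrt_mul (by positivity), mul_div_cancel₀ _ (by positivity)]

/-! ### The semidefinite bound is at least `ℓ_N` -/

section Equiangular

variable {ι E : Type*} [DecidableEq ι] [NormedAddCommGroup E] [InnerProductSpace ℝ E]

/-- Unit vectors with all pairwise inner products equal to `p`: the subgradients of a worst-case
instance. -/
def IsEquiangular (p : ℝ) (g : ι → E) : Prop :=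
  ∀ i k, ⟪g i, g k⟫ = if i = k then 1 else p

theorem isEquiangular_of_orthonormal {b : Option ι → E} (hb : Orthonormal ℝ b) {p : ℝ}
    (hp : p ∈ Set.Icc 0 1) :
    IsEquiangular p fun i => √p • b none + √(1 - p) • b (some i) := by
  intro i k
  have h0 := Real.mul_self_sqrt hp.1
  have h1 := Real.mul_self_sqrt (sub_nonneg.2 hp.2)
  rw [orthonormal_iff_ite] at hb
  simp only [inner_add_left, inner_add_right, inner_smul_left, inner_smul_right, hb, conj_trivial,
    Option.some.injEq, reduceCtorEq, if_true, if_false]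
  split_ifs <;> linarith

theorem exists_isEquiangular (ι : Type*) [Fintype ι] [DecidableEq ι] {p : ℝ}
    (hp : p ∈ Set.Icc 0 1) :
    ∃ g : ι → EuclideanSpace ℝ (Option ι), IsEquiangular p g :=
  ⟨_, isEquiangular_of_orthonormal EuclideanSpace.orthonormal_single hp⟩

variable {p : ℝ} {g : ι → E}

theorem IsEquiangular.norm_sq (hg : IsEquiangular p g) (i : ι) : ‖g i‖ ^ 2 = 1 := by
  rw [← real_inner_self_eq_norm_sq, hg, if_pos rfl]

theorem IsEquiangular.inner_sum_of_notMem (hg : IsEquiangular p g) {i : ι} {s : Finset ι}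
    (hi : i ∉ s) : ⟪g i, ∑ k ∈ s, g k⟫ = #s * p := by
  have hik : ∀ k ∈ s, ⟪g i, g k⟫ = p := fun k hk => by
    rw [hg, if_neg (ne_of_mem_of_not_mem hk hi).symm]
  rw [inner_sum, sum_congr rfl hik, sum_const, nsmul_eq_mul]

theorem IsEquiangular.norm_sum_sq (hg : IsEquiangular p g) (s : Finset ι) :
    ‖∑ i ∈ s, g i‖ ^ 2 = #s * (1 + (#s - 1) * p) := by
  induction s using Finset.induction_on with
  | empty => simp
  | insert i s hi ih =>
    rw [sum_insert hi, norm_add_sq_real, hg.norm_sq, hg.inner_sum_of_notMem hi, ih,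
      card_insert_of_notMem hi]
    push_cast
    ring

theorem IsEquiangular.inner_sub_smul_sum_eq_zero (hg : IsEquiangular p g) {i : ι} {s : Finset ι}
    (hi : i ∉ s) (hs : 1 + (#s - 1) * p ≠ 0) :
    ⟪g i - (p / (1 + (#s - 1) * p)) • ∑ k ∈ s, g k, ∑ k ∈ s, g k⟫ = 0 := by
  rw [inner_sub_left, inner_smul_left, conj_trivial, real_inner_self_eq_norm_sq,
    hg.inner_sum_of_notMem hi, hg.norm_sum_sq, mul_left_comm, div_mul_cancel₀ _ hs, sub_self]

theorem IsEquiangular.norm_smul_sum_sq (hg : IsEquiangular p g) (s : Finset ι) :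
    ‖(p / (1 + (#s - 1) * p)) • ∑ k ∈ s, g k‖ ^ 2 = #s * p ^ 2 / (1 + (#s - 1) * p) := by
  rw [norm_smul, mul_pow, Real.norm_eq_abs, sq_abs, hg.norm_sum_sq]
  field_simp

end Equiangular

section LowerBound

variable {N : ℕ} {νstar τ : ℝ} {ν : Fin (N + 1) → ℝ} {a : Fin N → ℝ}

theorem inner_sum_le_of_posSemidef_Lam {E : Type*} [NormedAddCommGroup E] [InnerProductSpace ℝ E]
    (hΛ : (Lam νstar ν τ a).PosSemidef) {x : E} {g : Fin (N + 1) → E} {e : Fin N → E}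
    (hx : ‖x‖ = 1) (hg : ∀ i, ‖g i‖ = 1)
    (he : ∀ j : Fin N, ⟪g j.castSucc + e j, ∑ i > j.castSucc, g i⟫ = 0) :
    ⟪x, ∑ i, g i⟫ ≤ (N + 1) * (τ * ∑ j, ‖e j‖ ^ 2 + νstar + ∑ i, ν i) := by
  have h := (sum_mul_inner_nonneg hΛ (Sum.elim (Sum.elim (fun _ => x) g) e)).trans_eq
    (sum_Lam_mul_inner νstar ν τ a x g e)
  simp only [hx, hg, he, one_pow, mul_one, mul_zero, sum_const_zero, add_zero] at h
  rw [← div_le_iff₀' (by positivity)]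
  linarith

theorem cast_card_Ioi_castSucc (j : Fin N) : (#(Ioi j.castSucc) : ℝ) = N - j := by
  rw [Fin.card_Ioi, Fin.val_castSucc, Nat.add_sub_cancel, Nat.cast_sub j.2.le]

theorem IsEquiangular.norm_sum {E : Type*} [NormedAddCommGroup E] [InnerProductSpace ℝ E] {p : ℝ}
    {g : Fin (N + 1) → E} (hg : IsEquiangular p g) :
    ‖∑ i, g i‖ = √((N : ℝ) + 1) * √(1 + N * p) := by
  rw [← Real.sqrt_mul (by positivity), ← Real.sqrt_sq (norm_nonneg _), hg.norm_sum_sq]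
  simp

theorem norm_sum_le_of_isEquiangular {E : Type*} [NormedAddCommGroup E] [InnerProductSpace ℝ E]
    (hΛ : (Lam νstar ν τ a).PosSemidef) {p : ℝ} (hp : 0 ≤ p) {g : Fin (N + 1) → E}
    (hg : IsEquiangular p g) :
    ‖∑ i, g i‖ ≤ (N + 1) *
      (τ * ∑ k ∈ range N, (((N : ℝ) - k) * p ^ 2) / (1 + ((N : ℝ) - (k + 1)) * p)
        + νstar + ∑ k, ν k) := by
  have hS : ‖∑ i, g i‖ ≠ 0 := by
    rw [hg.norm_sum]
    positivity
  have hx : ⟪‖∑ i, g i‖⁻¹ • ∑ i, g i, ∑ i, g i⟫ = ‖∑ i, g i‖ := by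
    rw [inner_smul_left, real_inner_self_eq_norm_sq, conj_trivial, sq, inv_mul_cancel_left₀ hS]
  have hden : ∀ j : Fin N, 1 + ((#(Ioi j.castSucc) : ℝ) - 1) * p ≠ 0 := fun j => by
    have hj : (j : ℝ) + 1 ≤ N := by exact_mod_cast j.2
    rw [cast_card_Ioi_castSucc]
    nlinarith
  let e : Fin N → E := fun j =>
    -((p / (1 + (#(Ioi j.castSucc) - 1) * p)) • ∑ i > j.castSucc, g i)
  have he_sq : ∀ j : Fin N,
      ‖e j‖ ^ 2 = (((N : ℝ) - j) * p ^ 2) / (1 + ((N : ℝ) - (j + 1)) * p) := fun j => by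
    rw [norm_neg, hg.norm_smul_sum_sq, cast_card_Ioi_castSucc, sub_sub]
  calc ‖∑ i, g i‖ = ⟪‖∑ i, g i‖⁻¹ • ∑ i, g i, ∑ i, g i⟫ := hx.symm
    _ ≤ (N + 1) * (τ * ∑ j, ‖e j‖ ^ 2 + νstar + ∑ i, ν i) :=
        inner_sum_le_of_posSemidef_Lam hΛ
          (by rw [norm_smul, norm_inv, norm_norm, inv_mul_cancel₀ hS])
          (fun i => by rw [← Real.sqrt_sq (norm_nonneg _), hg.norm_sq, Real.sqrt_one])
          fun j => by rw [← sub_eq_add_neg, hg.inner_sub_smul_sum_eq_zero (by simp) (hden j)]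
    _ = _ := by
        simp only [he_sq]
        rw [Fin.sum_univ_eq_sum_range
          fun k : ℕ => (((N : ℝ) - k) * p ^ 2) / (1 + ((N : ℝ) - (k + 1)) * p)]

theorem sqrt_one_add_mul_le_of_posSemidef_Lam (hΛ : (Lam νstar ν τ a).PosSemidef) {p : ℝ}
    (hp : p ∈ Set.Icc 0 1) :
    √(1 + N * p) ≤ √((N : ℝ) + 1) *
      (τ * ∑ k ∈ range N, (((N : ℝ) - k) * p ^ 2) / (1 + ((N : ℝ) - (k + 1)) * p)
        + νstar + ∑ k, ν k) := by
  obtain ⟨g, hg⟩ := exists_isEquiangular (Fin (N + 1)) hp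
  refine le_of_mul_le_mul_left ?_ (show 0 < √((N : ℝ) + 1) by positivity)
  rw [← hg.norm_sum, ← mul_assoc, Real.mul_self_sqrt (by positivity)]
  exact norm_sum_le_of_isEquiangular hΛ hp.1 hg

theorem ell_le_uS {R L σ : ℝ} (hN : 1 ≤ N) (hR : 0 < R) (hL : 0 < L)
    (hσ : σ ∈ Set.Icc 0 √(N : ℝ)) : ell N σ ≤ uS N R L σ := by
  obtain ⟨hν, hsum⟩ := nu_mem N hN σ hσ
  rw [uS, ← div_le_iff₀' (by positivity)]
  refine le_csInf (valuesS_nonempty N σ hR hL) ?_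
  rintro _ ⟨α, τ, νstar, μ, -, -, -, -, hΛ, rfl⟩
  rw [div_le_iff₀' (by positivity), ← hsum]
  exact sqrt_one_add_mul_le_of_posSemidef_Lam hΛ hν

end LowerBound

end SubgradSqueeze

theorem mainTheorem1 :
    (∀ (N : ℕ) (R L γ : ℝ), 1 ≤ N → 0 < R → 0 < L → γ / L ∈ Set.Icc 0 √(N : ℝ) →
      (1 - 5 / 2 * (Real.log ((N : ℝ) + 1) / N)) * SubgradSqueeze.u (γ / L)
          ≤ SubgradSqueeze.ell N (γ / L) ∧
        SubgradSqueeze.ell N (γ / L) ≤ SubgradSqueeze.uS N R L (γ / L) ∧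
        SubgradSqueeze.uS N R L (γ / L) ≤ SubgradSqueeze.uL N (γ / L) ∧
        SubgradSqueeze.uL N (γ / L) ≤ SubgradSqueeze.u (γ / L)) ∧
    (∃ C : ℝ, 0 < C ∧ ∀ (N : ℕ) (R L γ : ℝ), 2 ≤ N → 0 < R → 0 < L →
      γ / L ∈ Set.Icc 0 √(N : ℝ) →
      (SubgradSqueeze.uS N R L (γ / L) - SubgradSqueeze.ell N (γ / L))
            / SubgradSqueeze.ell N (γ / L) ≤ C * (Real.log N / N) ∧
        (SubgradSqueeze.uL N (γ / L) - SubgradSqueeze.ell N (γ / L))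
            / SubgradSqueeze.ell N (γ / L) ≤ C * (Real.log N / N) ∧
        (SubgradSqueeze.u (γ / L) - SubgradSqueeze.ell N (γ / L))
            / SubgradSqueeze.ell N (γ / L) ≤ C * (Real.log N / N)) := by
  refine ⟨fun N R L γ hN hR hL hσ => ⟨?_, SubgradSqueeze.ell_le_uS hN hR hL hσ,
    SubgradSqueeze.uS_le_uL N _ hR hL, SubgradSqueeze.uL_le_u N _⟩, 1, one_pos,
    fun N R L γ hN hR hL hσ => ?_⟩
  · exact SubgradSqueeze.one_sub_mul_u_le_ell hN hσ (by norm_num)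
  · have huL := SubgradSqueeze.uL_le_u N (γ / L)
    have huS := (SubgradSqueeze.uS_le_uL N (γ / L) hR hL).trans huL
    rw [one_mul]
    exact ⟨SubgradSqueeze.sub_ell_div_ell_le hN hσ huS, SubgradSqueeze.sub_ell_div_ell_le hN hσ huL,
      SubgradSqueeze.sub_ell_div_ell_le hN hσ le_rfl⟩
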